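/- **Setting.** An instance of amplitude estimation consists of a unitary $A$ on $\mathbb{C}^n$ ($n\ge 1$) and an orthogonal projection $\Pi$ on $\mathbb{C}^n$; its amplitude is $a=\|\Pi A|0\rangle\|^2\in[0,1]$. A quantum query algorithm acts on $\mathbb{C}^n$ and a finite-dimensional workspace, starts in a fixed basis state, alternates instance-independent unitaries with (controlled) oracle calls to $A$, $A^{-1}$ or $I-2\Pi$ (one Grover operator uses one call of each kind), and finally measures all registers and outputs a real function of the outcome. Its number of oracle calls is its query complexity, which for a single run is also its depth. For independent runs in parallel, the depth $D$ is the maximum and the total query complexity $N$ is the sum of the numbers of calls of the runs. An *unbiased amplitude estimation algorithm* is a family of such algorithms, one for each $n$, $K\ge 4$ and $B\in(0,1)$, such that on every instance the output $\tilde a$ lies in $[0,1]$ almost surely and $$|\mathbb{E}[\tilde a]-a|\le B,\qquad \mathrm{Var}[\tilde a]\le \frac{91a}{K^2}+B,$$ with $O\big(K\log\log (K)\,\log(K/B)\big)$ oracle calls, where the constant does not depend on $n,K,B$. **Proposition (low-depth amplitude estimation).** An unbiased amplitude estimation algorithm exists. Moreover, let any unbiased amplitude estimation algorithm be given. For $\epsilon_\circ\in(0,1)$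 and $\beta\in[0,1]$ run it independently $T=\lceil \epsilon_\circ^{-2\beta}\rceil$ times with the parameters $$K=15\,\epsilon_\circ^{-1+\beta},\qquad B=\min\Big(\tfrac{9}{225}\,\epsilon_\circ^{2-2\beta},\;0.05\,\epsilon_\circ\Big).$$ Then, for every instance, the sample mean $\bar a$ of the $T$ outputs satisfies $$P\big[|\bar a-a|\le \epsilon_\circ\big]>\tfrac12 .$$ The depth and the total query complexity of obtaining $\bar a$ are $$D=O\big(\epsilon_\circ^{-1+\beta}\log\log(\epsilon_\circ^{-1})\log(\epsilon_\circ^{-1})\big),\qquad N=O\big(\epsilon_\circ^{-1-\beta}\log\log(\epsilon_\circ^{-1})\log(\epsilon_\circ^{-1})\big),$$ that is, for some constant $C$ that depends only on the algorithm family (not on $\epsilon_\circ$, $\beta$ or $n$), both bounds hold with $C$ in place of $O(\cdot)$ for all $0<\epsilon_\circ\le 1/16$ and $\beta\in[0,1]$. -/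

import Mathlib

open MeasureTheory ProbabilityTheory

noncomputable section

namespace LowDepthQAE

/-! ### The amplitude estimation problem -/

/-- An instance of amplitude estimation on an `n`-dimensional register: a unitary `A` preparing the
state `|ψ⟩ = A|0⟩`, and an orthogonal projection `Π` onto the good subspace. Both are black boxes. -/
structure Instance (n : ℕ) where
  prep : Matrix.unitaryGroup (Fin n) ℂ
  proj : Matrix (Fin n) (Fin n) ℂ
  proj_herm : proj.IsHermitian
  proj_idem : proj * proj = proj

/-- The amplitude `a = ‖Π A |0⟩‖²`. -/
def Instance.amplitude {n : ℕ} [NeZero n] (I : Instance n) : ℝ :=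
  ∑ i, ‖(I.proj * (I.prep : Matrix (Fin n) (Fin n) ℂ)) i 0‖ ^ 2

/-! ### Quantum query algorithms -/

/-- The oracle calls: `A`, its inverse, and the reflection `1 - 2Π`. One Grover operator
`A (2|0⟩⟨0| - 1) A⁻¹ (1 - 2Π)` is made of one call of each kind, so that counting Grover operators
and counting oracle calls agree up to a constant factor. -/
inductive Query where
  | prep
  | prepInv
  | reflect

/-- The unitary that an oracle call applies to the `n`-dimensional register. -/
def Instance.oracle {n : ℕ} (I : Instance n) : Query → Matrix (Fin n) (Fin n) ℂ
  | .prep => I.prep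
  | .prepInv => star (I.prep : Matrix (Fin n) (Fin n) ℂ)
  | .reflect => 1 - 2 * I.proj

/-- `M` applied to the first register, controlled on the basis state of the workspace (the second
register) lying in `c`. -/
def controlled {n w : ℕ} (c : Finset (Fin w)) (M : Matrix (Fin n) (Fin n) ℂ) :
    Matrix (Fin n × Fin w) (Fin n × Fin w) ℂ :=
  Matrix.blockDiagonal fun k => if k ∈ c then M else 1

/-- A quantum query algorithm (with measurements deferred to the end) for an `n`-dimensional
register and a workspace of dimension `ancilla + 1`. It starts in `|0⟩|0⟩`, applies the unitary
`start`, then for each member `(q, c, V)` of `steps` in turn makes the oracle call `q` controlled on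
`c` and applies the unitary `V`; at the end all registers are measured in the computational basis,
and `output` of the outcome is returned. Nothing in it depends on the instance. -/
structure QueryAlg (n : ℕ) where
  ancilla : ℕ
  start : Matrix.unitaryGroup (Fin n × Fin (ancilla + 1)) ℂ
  steps : List (Query × Finset (Fin (ancilla + 1)) ×
    Matrix.unitaryGroup (Fin n × Fin (ancilla + 1)) ℂ)
  output : Fin n × Fin (ancilla + 1) → ℝ

namespace QueryAlg

variable {n : ℕ}

/-- The number of oracle calls, which are made one after the other. -/
def queries (𝒜 : QueryAlg n) : ℕ := 𝒜.steps.length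

/-- The state reached from `v` by the given steps. -/
def runSteps {w : ℕ} (I : Instance n) (v : Fin n × Fin w → ℂ)
    (l : List (Query × Finset (Fin w) × Matrix.unitaryGroup (Fin n × Fin w) ℂ)) :
    Fin n × Fin w → ℂ :=
  l.foldl (fun u s => (s.2.2 : Matrix (Fin n × Fin w) (Fin n × Fin w) ℂ).mulVec
    ((controlled s.2.1 (I.oracle s.1)).mulVec u)) v

/-- The state just before the measurement. -/
def finalState [NeZero n] (𝒜 : QueryAlg n) (I : Instance n) : Fin n × Fin (𝒜.ancilla + 1) → ℂ :=
  runSteps I ((𝒜.start : Matrix (Fin n × Fin (𝒜.ancilla + 1)) (Fin n × Fin (𝒜.ancilla + 1)) ℂ).mulVec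
    (Pi.single (0, 0) 1)) 𝒜.steps

end QueryAlg

/-! ### Unitarity, needed for the outcome probabilities to add up to one -/

theorem sum_norm_sq_mulVec {ι : Type*} [Fintype ι] [DecidableEq ι] {M : Matrix ι ι ℂ}
    (hM : M ∈ Matrix.unitaryGroup ι ℂ) (v : ι → ℂ) :
    ∑ x, ‖M.mulVec v x‖ ^ 2 = ∑ x, ‖v x‖ ^ 2 := by
  have key : ∀ u : ι → ℂ, ((∑ x, ‖u x‖ ^ 2 : ℝ) : ℂ) = star u ⬝ᵥ u := by
    intro u
    simp [dotProduct, Complex.conj_mul']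
  have h : star M * M = 1 := Matrix.mem_unitaryGroup_iff'.1 hM
  apply Complex.ofReal_injective
  rw [key, key, Matrix.star_mulVec, Matrix.dotProduct_mulVec, Matrix.vecMul_vecMul,
    ← Matrix.star_eq_conjTranspose, h, Matrix.vecMul_one]

theorem Instance.oracle_mem {n : ℕ} (I : Instance n) (q : Query) :
    I.oracle q ∈ Matrix.unitaryGroup (Fin n) ℂ := by
  cases q with
  | prep => exact I.prep.2
  | prepInv => exact (star I.prep).2
  | reflect =>
    have h : star I.proj = I.proj := I.proj_herm
    have hi := I.proj_idem
    rw [Matrix.mem_unitaryGroup_iff]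
    simp only [Instance.oracle, star_sub, star_one, star_mul, star_ofNat, h]
    have : (1 - 2 * I.proj) * (1 - I.proj * 2) = 1 - 4 * I.proj + 4 * (I.proj * I.proj) := by
      noncomm_ring
    rw [this, hi]
    abel

theorem controlled_mem {n w : ℕ} (c : Finset (Fin w)) {M : Matrix (Fin n) (Fin n) ℂ}
    (hM : M ∈ Matrix.unitaryGroup (Fin n) ℂ) :
    controlled c M ∈ Matrix.unitaryGroup (Fin n × Fin w) ℂ := by
  rw [Matrix.mem_unitaryGroup_iff, Matrix.star_eq_conjTranspose, controlled,
    Matrix.blockDiagonal_conjTranspose, ← Matrix.blockDiagonal_mul, ← Matrix.blockDiagonal_one]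
  congr 1
  funext k
  have h := Matrix.mem_unitaryGroup_iff.1 hM
  rw [Matrix.star_eq_conjTranspose] at h
  by_cases hk : k ∈ c <;> simp [hk, h]

theorem QueryAlg.sum_norm_sq_runSteps {n w : ℕ} (I : Instance n)
    (l : List (Query × Finset (Fin w) × Matrix.unitaryGroup (Fin n × Fin w) ℂ))
    (v : Fin n × Fin w → ℂ) :
    ∑ x, ‖QueryAlg.runSteps I v l x‖ ^ 2 = ∑ x, ‖v x‖ ^ 2 := by
  induction l generalizing v with
  | nil => rfl
  | cons s l ih =>
    have := ih ((s.2.2 : Matrix (Fin n × Fin w) (Fin n × Fin w) ℂ).mulVec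
      ((controlled s.2.1 (I.oracle s.1)).mulVec v))
    rw [sum_norm_sq_mulVec s.2.2.2, sum_norm_sq_mulVec (controlled_mem _ (I.oracle_mem _))] at this
    exact this

theorem QueryAlg.sum_norm_sq_finalState {n : ℕ} [NeZero n] (𝒜 : QueryAlg n) (I : Instance n) :
    ∑ x, ‖𝒜.finalState I x‖ ^ 2 = 1 := by
  rw [QueryAlg.finalState, QueryAlg.sum_norm_sq_runSteps, sum_norm_sq_mulVec 𝒜.start.2,
    Finset.sum_eq_single (0, 0)]
  · simp
  · intro b _ hb
    simp [Pi.single_eq_of_ne hb]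
  · simp

/-! ### The law of the output -/

namespace QueryAlg

variable {n : ℕ} [NeZero n]

/-- Born rule: the outcome `x` of the final measurement has probability `|⟨x|final state⟩|²`. -/
def outcome (𝒜 : QueryAlg n) (I : Instance n) : PMF (Fin n × Fin (𝒜.ancilla + 1)) :=
  PMF.ofFintype (fun x => ENNReal.ofReal (‖𝒜.finalState I x‖ ^ 2)) (by
    rw [← ENNReal.ofReal_sum_of_nonneg (fun _ _ => by positivity), 𝒜.sum_norm_sq_finalState I,
      ENNReal.ofReal_one])

/-- The law of the estimate returned by the algorithm. -/
def law (𝒜 : QueryAlg n) (I : Instance n) : Measure ℝ :=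
  ((𝒜.outcome I).map 𝒜.output).toMeasure

end QueryAlg

/-! ### Unbiased amplitude estimation -/

/-- A quantum query algorithm for every dimension `n` of the register and every choice of the
parameters `K` and `B`. -/
abbrev AlgFamily : Type := (n : ℕ) → [NeZero n] → (K B : ℝ) → QueryAlg n

/-- The guarantee of unbiased amplitude estimation: for all `K ≥ 4` and `B ∈ (0, 1)` the estimate
lies in `[0, 1]`, has bias at most `B` and variance at most `91 a / K² + B`, and
`O(K log log K log (K / B))` oracle calls are made. -/
structure IsUnbiasedAE (F : AlgFamily) : Prop where
  mem_Icc : ∀ (n : ℕ) [NeZero n] (K B : ℝ), 4 ≤ K → 0 < B → B < 1 → ∀ I : Instance n,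
    ∀ᵐ y ∂((F n K B).law I), y ∈ Set.Icc (0 : ℝ) 1
  bias : ∀ (n : ℕ) [NeZero n] (K B : ℝ), 4 ≤ K → 0 < B → B < 1 → ∀ I : Instance n,
    |(∫ y, y ∂((F n K B).law I)) - I.amplitude| ≤ B
  variance : ∀ (n : ℕ) [NeZero n] (K B : ℝ), 4 ≤ K → 0 < B → B < 1 → ∀ I : Instance n,
    ProbabilityTheory.variance (fun y : ℝ => y) ((F n K B).law I) ≤
      91 * I.amplitude / K ^ 2 + B
  queries : ∃ C : ℝ, ∀ (n : ℕ) [NeZero n] (K B : ℝ), 4 ≤ K → 0 < B → B < 1 →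
    ((F n K B).queries : ℝ) ≤ C * (K * Real.log (Real.log K) * Real.log (K / B))

/-! ### Independent runs in parallel -/

section Parallel

variable {n T : ℕ}

/-- The joint law of the estimates of independent runs. -/
def parallelLaw [NeZero n] (runs : Fin T → QueryAlg n) (I : Instance n) : Measure (Fin T → ℝ) :=
  Measure.pi fun i => (runs i).law I

/-- The maximum depth: the largest number of consecutive oracle calls in one of the runs. -/
def parallelDepth (runs : Fin T → QueryAlg n) : ℕ := Finset.univ.sup fun i => (runs i).queries

/-- The total query complexity. -/
def parallelQueries (runs : Fin T → QueryAlg n) : ℕ := ∑ i, (runs i).queries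

/-- The sample mean. -/
def sampleMean (y : Fin T → ℝ) : ℝ := (∑ i, y i) / T

end Parallel

/-! ### The parameters -/

/-- The number of runs `T = ⌈ε^(-2β)⌉`. -/
def paramT (ε β : ℝ) : ℕ := ⌈ε ^ (-2 * β)⌉₊

/-- `K = 15 ε^(-1+β)`. -/
def paramK (ε β : ℝ) : ℝ := 15 * ε ^ (-1 + β)

/-- `B = min (9/225 ε^(2-2β), 0.05 ε)`. -/
def paramB (ε β : ℝ) : ℝ := min (9 / 225 * ε ^ (2 - 2 * β)) (0.05 * ε)

/-- The `T` runs of the algorithm with the parameters `K` and `B` above. -/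
def lowDepthRuns (F : AlgFamily) (n : ℕ) [NeZero n] (ε β : ℝ) : Fin (paramT ε β) → QueryAlg n :=
  fun _ => F n (paramK ε β) (paramB ε β)

end LowDepthQAE

end

/-! Existence. With ψ = A|0⟩ and G the Grover operator, the vectors ψ_j = G^j ψ form the orbit of a
planar rotation: they are unit vectors, ψ_{j+2} + ψ_j = 2C ψ_{j+1}, and Re⟨ψ_j, ψ_{j+1}⟩ = C, where
C = 1 - 2a. So any average p ψ_{j+1} + q ψ_{j-1} with p + q = 1 has real inner product exactly C
with ψ_j and squared norm C² + (p - q)²(1 - C²) (`reInner_neighbour_average`).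

Take a reversible nearest-neighbour walk on a path with stationary law π, prepare ∑ √π_k |k⟩
ψ_{k+1}, and measure the symmetrized transition matrix on the workspace. It replaces each branch by
the average of its neighbours, so the outcome λ has mean exactly C and variance (1 - C²) ∑ π_k (p_k
- q_k)². Hence (1 - λ)/2 has mean exactly a, variance a(1 - a) times the mean squared drift, and
lies in [0, 1] because the walk has spectrum in [-1, 1] (`mean_variance_walk`). If the edge
conductances are squares of a 1-Lipschitz f vanishing at both ends, the mean squared drift on a path
with w sites is at most 2w/∑(f_{k+1}² + f_k²). For the tent function this is O(1/w²), so w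
proportional to K suffices: O(K) queries and no bias (`isUnbiasedAE_walkFamily`).

Sample mean. For an arbitrary family, T runs divide the variance by T, and the parameters make the
variance of the mean at most (100/225) ε², with bias at most 0.05 ε. Chebyshev at distance 0.95 ε
gives failure probability at most (100/225)/0.95² < 1/2. The complexity bounds compare K, log log K
and log(K/B) with powers and logarithms of 1/ε. -/

open MeasureTheory ProbabilityTheory

namespace LowDepthQAE

/-! ### The real part of the inner product -/

/-- The real part of the standard inner product. -/
def reInner {ι : Type*} [Fintype ι] (u v : ι → ℂ) : ℝ := (star u ⬝ᵥ v).re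

section ReInner

variable {ι : Type*} [Fintype ι]

theorem reInner_self (u : ι → ℂ) : reInner u u = ∑ x, ‖u x‖ ^ 2 := by
  simp only [reInner, dotProduct, Pi.star_apply, RCLike.star_def, Complex.conj_mul', Complex.re_sum]
  refine Finset.sum_congr rfl fun x _ => ?_
  norm_cast

theorem reInner_comm (u v : ι → ℂ) : reInner u v = reInner v u := by
  simp only [reInner, dotProduct, Pi.star_apply, RCLike.star_def, Complex.re_sum, Complex.mul_re,
    Complex.conj_re, Complex.conj_im]
  exact Finset.sum_congr rfl fun x _ => by ring

theorem reInner_add_right (u v w : ι → ℂ) : reInner u (v + w) = reInner u v + reInner u w := by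
  simp [reInner, dotProduct_add]

theorem reInner_add_left (u v w : ι → ℂ) : reInner (u + v) w = reInner u w + reInner v w := by
  simp [reInner, add_dotProduct]

theorem reInner_sub_right (u v w : ι → ℂ) : reInner u (v - w) = reInner u v - reInner u w := by
  simp [reInner, dotProduct_sub]

theorem reInner_smul_right (c : ℝ) (u v : ι → ℂ) :
    reInner u ((c : ℂ) • v) = c * reInner u v := by
  simp [reInner, dotProduct_smul]

theorem reInner_smul_left (c : ℝ) (u v : ι → ℂ) :
    reInner ((c : ℂ) • u) v = c * reInner u v := by
  rw [reInner_comm, reInner_smul_right, reInner_comm]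

theorem reInner_mulVec_unitary [DecidableEq ι] {M : Matrix ι ι ℂ}
    (hM : M ∈ Matrix.unitaryGroup ι ℂ) (u v : ι → ℂ) :
    reInner (M.mulVec u) (M.mulVec v) = reInner u v := by
  have h : star M * M = 1 := Matrix.mem_unitaryGroup_iff'.1 hM
  rw [reInner, Matrix.star_mulVec, Matrix.dotProduct_mulVec, Matrix.vecMul_vecMul,
    ← Matrix.star_eq_conjTranspose, h, Matrix.vecMul_one, reInner]

/-- Weighted averages of the two neighbours of a unit vector in a planar rotation orbit. -/
theorem reInner_neighbour_average {x y z : ι → ℂ} {C p q : ℝ} (hpq : p + q = 1)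
    (hsum : z + x = ((2 * C : ℝ) : ℂ) • y) (hx : reInner x x = 1) (hy : reInner y y = 1)
    (hz : reInner z z = 1) (hyz : reInner y z = C) :
    reInner y ((p : ℂ) • z + (q : ℂ) • x) = C ∧
      reInner ((p : ℂ) • z + (q : ℂ) • x) ((p : ℂ) • z + (q : ℂ) • x)
        = C ^ 2 + (p - q) ^ 2 * (1 - C ^ 2) := by
  have h1 : reInner y z + reInner y x = 2 * C := by
    rw [← reInner_add_right, hsum, reInner_smul_right, hy, mul_one]
  -- Taking the squared norm of `z + x = 2C y` fixes the remaining inner product of `x` and `z`.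
  have h2 : reInner z z + reInner z x + (reInner x z + reInner x x) = (2 * C) * (2 * C) := by
    rw [← reInner_add_right, ← reInner_add_right, ← reInner_add_left, hsum, reInner_smul_right,
      reInner_smul_left, hy, mul_one]
  have h3 := reInner_comm x z
  simp only [reInner_add_right, reInner_add_left, reInner_smul_right, reInner_smul_left]
  have hq : q = 1 - p := by linarith
  subst hq
  constructor
  · linear_combination p * hyz + (1 - p) * (h1 - hyz)
  · linear_combination (p ^ 2 - p * (1 - p)) * hz + ((1 - p) ^ 2 - p * (1 - p)) * hx
      + p * (1 - p) * h2

end ReInner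

/-! ### Grover rotations -/

theorem Instance.reflect_mul_reflect {n : ℕ} (I : Instance n) :
    I.oracle .reflect * I.oracle .reflect = 1 := by
  have hi := I.proj_idem
  have : (1 - 2 * I.proj) * (1 - 2 * I.proj) = 1 - 4 * I.proj + 4 * (I.proj * I.proj) := by
    noncomm_ring
  rw [Instance.oracle, this, hi]
  abel

section Grover

variable {n : ℕ} [NeZero n]

/-- The reflection `2|0⟩⟨0| - 1`. -/
def zeroReflection (n : ℕ) [NeZero n] : Matrix (Fin n) (Fin n) ℂ :=
  Matrix.diagonal fun i => if i = 0 then 1 else -1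

theorem zeroReflection_mem : zeroReflection n ∈ Matrix.unitaryGroup (Fin n) ℂ := by
  rw [Matrix.mem_unitaryGroup_iff, zeroReflection, Matrix.star_eq_conjTranspose,
    Matrix.diagonal_conjTranspose, Matrix.diagonal_mul_diagonal, ← Matrix.diagonal_one]
  congr 1
  funext i
  by_cases h : i = 0 <;> simp [h]

theorem zeroReflection_mulVec (v : Fin n → ℂ) :
    (zeroReflection n).mulVec v = (2 * v 0) • Pi.single 0 1 - v := by
  funext i
  rw [zeroReflection, Matrix.mulVec_diagonal]
  by_cases h : i = 0
  · subst h; simp; ring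
  · simp [h]

/-- The state `|ψ⟩ = A|0⟩`. -/
def Instance.state (I : Instance n) : Fin n → ℂ :=
  (I.prep : Matrix (Fin n) (Fin n) ℂ).mulVec (Pi.single 0 1)

/-- The Grover operator `A (2|0⟩⟨0| - 1) A⁻¹ (1 - 2Π)`. -/
def Instance.grover (I : Instance n) : Matrix (Fin n) (Fin n) ℂ :=
  I.oracle .prep * (zeroReflection n * (I.oracle .prepInv * I.oracle .reflect))

theorem Instance.grover_mem (I : Instance n) : I.grover ∈ Matrix.unitaryGroup (Fin n) ℂ :=
  mul_mem (I.oracle_mem _) (mul_mem zeroReflection_mem (mul_mem (I.oracle_mem _) (I.oracle_mem _)))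

theorem Instance.state_dotProduct_self (I : Instance n) : star I.state ⬝ᵥ I.state = 1 := by
  have h : star (I.prep : Matrix (Fin n) (Fin n) ℂ) * I.prep = 1 :=
    Matrix.mem_unitaryGroup_iff'.1 I.prep.2
  rw [Instance.state, Matrix.star_mulVec, Matrix.dotProduct_mulVec, Matrix.vecMul_vecMul,
    ← Matrix.star_eq_conjTranspose, h, Matrix.vecMul_one]
  simp

/-- Conjugating 2|0⟩⟨0| - 1 by A turns it into the reflection 2|ψ⟩⟨ψ| - 1. -/
theorem Instance.grover_mulVec (I : Instance n) (v : Fin n → ℂ) :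
    I.grover.mulVec v = (2 * (star I.state ⬝ᵥ (I.oracle .reflect).mulVec v)) • I.state
      - (I.oracle .reflect).mulVec v := by
  have h : (I.prep : Matrix (Fin n) (Fin n) ℂ) * star (I.prep : Matrix (Fin n) (Fin n) ℂ) = 1 :=
    Matrix.mem_unitaryGroup_iff.1 I.prep.2
  rw [Instance.grover, ← Matrix.mulVec_mulVec, ← Matrix.mulVec_mulVec, ← Matrix.mulVec_mulVec,
    zeroReflection_mulVec, Matrix.mulVec_sub, Matrix.mulVec_smul]
  set y := (I.oracle .reflect).mulVec v
  have h0 : (I.oracle .prepInv).mulVec y 0 = star I.state ⬝ᵥ y := by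
    rw [Instance.state, Matrix.star_mulVec, ← Matrix.dotProduct_mulVec,
      ← Matrix.star_eq_conjTranspose]
    simp [Instance.oracle]
  have h1 : (I.oracle .prep).mulVec ((I.oracle .prepInv).mulVec y) = y := by
    rw [Matrix.mulVec_mulVec]
    simp [Instance.oracle, h]
  rw [h0, h1]
  rfl

theorem Instance.amplitude_eq (I : Instance n) :
    ((I.amplitude : ℝ) : ℂ) = star I.state ⬝ᵥ I.proj.mulVec I.state := by
  have h : ∀ i, (I.proj * (I.prep : Matrix (Fin n) (Fin n) ℂ)) i 0 = I.proj.mulVec I.state i := by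
    intro i
    rw [Instance.state, Matrix.mulVec_mulVec, Matrix.mulVec_single_one]
    rfl
  have key : ∀ u : Fin n → ℂ, ((∑ x, ‖u x‖ ^ 2 : ℝ) : ℂ) = star u ⬝ᵥ u := by
    intro u
    simp [dotProduct, Complex.conj_mul']
  simp only [Instance.amplitude, h]
  rw [key, Matrix.star_mulVec, Matrix.dotProduct_mulVec, Matrix.vecMul_vecMul, I.proj_herm.eq,
    I.proj_idem, ← Matrix.dotProduct_mulVec]

theorem Instance.state_dotProduct_reflect (I : Instance n) :
    star I.state ⬝ᵥ (I.oracle .reflect).mulVec I.state = ((1 - 2 * I.amplitude : ℝ) : ℂ) := by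
  have h2 : (2 : Matrix (Fin n) (Fin n) ℂ) * I.proj = (2 : ℂ) • I.proj := by
    rw [two_smul, two_mul]
  rw [Instance.oracle, Matrix.sub_mulVec, Matrix.one_mulVec, h2, Matrix.smul_mulVec,
    dotProduct_sub, dotProduct_smul, ← I.amplitude_eq, I.state_dotProduct_self]
  push_cast
  rfl

/-- The orbit of the initial state under the Grover operator. -/
def Instance.orbit (I : Instance n) (j : ℕ) : Fin n → ℂ := (I.grover ^ j).mulVec I.state

theorem Instance.grover_mulVec_orbit (I : Instance n) (j : ℕ) :
    I.grover.mulVec (I.orbit j) = I.orbit (j + 1) := by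
  rw [Instance.orbit, Matrix.mulVec_mulVec, ← pow_succ', Instance.orbit]

theorem Instance.grover_mulVec_state (I : Instance n) :
    I.grover.mulVec I.state = ((2 * (1 - 2 * I.amplitude) : ℝ) : ℂ) • I.state
      - (I.oracle .reflect).mulVec I.state := by
  rw [I.grover_mulVec, I.state_dotProduct_reflect]
  push_cast
  rfl

/-- The orbit is that of a planar rotation. -/
theorem Instance.orbit_add (I : Instance n) (j : ℕ) :
    I.orbit (j + 2) + I.orbit j = ((2 * (1 - 2 * I.amplitude) : ℝ) : ℂ) • I.orbit (j + 1) := by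
  -- The reflection squares to 1, so G undoes it on ψ. Applying G to Gψ = 2Cψ - Rψ, with R = 1 - 2Π,
  -- then gives the recurrence at the start of the orbit; G^j transports it.
  have h2 : I.grover.mulVec ((I.oracle .reflect).mulVec I.state) = I.state := by
    rw [I.grover_mulVec, Matrix.mulVec_mulVec, I.reflect_mul_reflect, Matrix.one_mulVec,
      I.state_dotProduct_self, mul_one, two_smul, add_sub_cancel_right]
  have h : I.grover.mulVec (I.grover.mulVec I.state) + I.state
      = ((2 * (1 - 2 * I.amplitude) : ℝ) : ℂ) • I.grover.mulVec I.state := by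
    conv_lhs => rw [I.grover_mulVec_state]
    rw [Matrix.mulVec_sub, Matrix.mulVec_smul, h2, sub_add_cancel]
  have h' := congrArg (fun v => (I.grover ^ j).mulVec v) h
  simp only [Matrix.mulVec_add, Matrix.mulVec_smul, Matrix.mulVec_mulVec] at h'
  simpa only [Instance.orbit, pow_succ, pow_zero, one_mul, mul_assoc] using h'

theorem Instance.reInner_orbit_self (I : Instance n) (j : ℕ) :
    reInner (I.orbit j) (I.orbit j) = 1 := by
  rw [Instance.orbit, reInner_mulVec_unitary (pow_mem I.grover_mem j), reInner,
    I.state_dotProduct_self, Complex.one_re]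

/-- By unitarity only ⟨ψ, Gψ⟩ matters, and this is 2C - C with C = ⟨ψ, (1 - 2Π)ψ⟩. -/
theorem Instance.reInner_orbit_succ (I : Instance n) (j : ℕ) :
    reInner (I.orbit j) (I.orbit (j + 1)) = 1 - 2 * I.amplitude := by
  rw [Instance.orbit, Instance.orbit, pow_succ, ← Matrix.mulVec_mulVec,
    reInner_mulVec_unitary (pow_mem I.grover_mem j), I.grover_mulVec_state, reInner_sub_right,
    reInner_smul_right, reInner, reInner, I.state_dotProduct_self, I.state_dotProduct_reflect,
    Complex.one_re, Complex.ofReal_re]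
  ring

theorem Instance.amplitude_nonneg (I : Instance n) : 0 ≤ I.amplitude :=
  Finset.sum_nonneg fun _ _ => by positivity

/-- The squared norm of ψ + Gψ equals 4 - 4a. -/
theorem Instance.amplitude_le_one (I : Instance n) : I.amplitude ≤ 1 := by
  have h : 0 ≤ reInner (I.orbit 0 + I.orbit 1) (I.orbit 0 + I.orbit 1) := by
    rw [reInner_self]; positivity
  rw [reInner_add_left, reInner_add_right, reInner_add_right, I.reInner_orbit_self,
    I.reInner_orbit_self, reInner_comm (I.orbit 1), I.reInner_orbit_succ 0] at h
  linarith

end Grover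

/-! ### Reversible random walks on a path -/

section Walk

variable (f : ℕ → ℝ) (w : ℕ)

/-- The conductance matrix of the path `0 - 1 - 2 - ⋯` in which the edge between `k` and `k + 1`
has conductance `f (k + 1) ^ 2`. -/
def conductance (k l : ℕ) : ℝ :=
  (if l = k + 1 then f (k + 1) ^ 2 else 0) + (if k = l + 1 then f k ^ 2 else 0)

/-- The reversible measure of the walk. -/
def pathWeight (k : ℕ) : ℝ := f (k + 1) ^ 2 + f k ^ 2

/-- The transition matrix of the walk, symmetrized by the square root of the reversible measure. -/
noncomputable def walkMatrix : Matrix (Fin w) (Fin w) ℂ :=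
  Matrix.of fun k l => ((conductance f k l / (√(pathWeight f k) * √(pathWeight f l)) : ℝ) : ℂ)

variable {f w}

theorem pathWeight_nonneg (k : ℕ) : 0 ≤ pathWeight f k := by
  unfold pathWeight
  positivity

theorem conductance_nonneg (k l : ℕ) : 0 ≤ conductance f k l := by
  unfold conductance
  positivity

theorem conductance_comm (k l : ℕ) : conductance f k l = conductance f l k := by
  unfold conductance
  rw [add_comm]
  congr 1
  · by_cases h : k = l + 1 <;> simp [h]
  · by_cases h : l = k + 1 <;> simp [h]

/-- Site k carries `g (k + 1)`, so the neighbours of the end sites would be `g 0` and `g (w + 1)`,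
which belong to no site. Their coefficients are `f 0 ^ 2` and `f w ^ 2`; this is why f must vanish
at both ends. -/
theorem sum_conductance_smul {E : Type*} [AddCommGroup E] [Module ℝ E] (h0 : f 0 = 0)
    (hw : f w = 0) (g : ℕ → E) {k : ℕ} (hk : k < w) :
    ∑ l : Fin w, conductance f k l • g (l + 1) = f (k + 1) ^ 2 • g (k + 2) + f k ^ 2 • g k := by
  rw [Fin.sum_univ_eq_sum_range fun l => conductance f k l • g (l + 1)]
  simp only [conductance, add_smul, Finset.sum_add_distrib, ite_smul, zero_smul]
  congr 1
  · rw [Finset.sum_ite_eq' (Finset.range w) (k + 1) fun l => f (k + 1) ^ 2 • g (l + 1)]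
    split_ifs with h
    · rfl
    · have : k + 1 = w := by
        rw [Finset.mem_range] at h
        omega
      simp [this, hw]
  · cases k with
    | zero => simp [h0]
    | succ k =>
      simp only [Nat.add_right_cancel_iff]
      rw [Finset.sum_ite_eq (Finset.range w) k fun l => f (k + 1) ^ 2 • g (l + 1),
        if_pos (Finset.mem_range.2 (by omega))]

theorem sum_conductance (h0 : f 0 = 0) (hw : f w = 0) (k : Fin w) :
    ∑ l : Fin w, conductance f k l = pathWeight f k := by
  simpa [pathWeight] using sum_conductance_smul h0 hw (fun _ => (1 : ℝ)) k.2

variable (f w) in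
theorem walkMatrix_isHermitian : (walkMatrix f w).IsHermitian := by
  ext k l
  simp only [walkMatrix, Matrix.conjTranspose_apply, Matrix.of_apply, RCLike.star_def,
    Complex.conj_ofReal]
  rw [conductance_comm, mul_comm]

/-- The spectrum of the walk lies in `[-1, 1]`. -/
theorem abs_reInner_walkMatrix_le (h0 : f 0 = 0) (hw : f w = 0)
    (hpos : ∀ k < w, 0 < pathWeight f k) (u : Fin w → ℂ) :
    |reInner u ((walkMatrix f w).mulVec u)| ≤ ∑ k, ‖u k‖ ^ 2 := by
  -- In the variable |u|/√π (π unnormalized) the quadratic form has the conductances as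
  -- coefficients. AM-GM on each edge and the symmetry of the conductances reduce it to ∑ π h².
  set h : Fin w → ℝ := fun k => ‖u k‖ / √(pathWeight f k) with hh
  have hu : ∀ k : Fin w, pathWeight f k * h k ^ 2 = ‖u k‖ ^ 2 := by
    intro k
    have := hpos k k.2
    rw [hh, div_pow, Real.sq_sqrt this.le]
    field_simp
  calc |reInner u ((walkMatrix f w).mulVec u)|
      ≤ ‖star u ⬝ᵥ (walkMatrix f w).mulVec u‖ := Complex.abs_re_le_norm _
    _ ≤ ∑ k : Fin w, ∑ l : Fin w, conductance f k l * (h k * h l) := by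
        refine (norm_sum_le _ _).trans (Finset.sum_le_sum fun k _ => ?_)
        rw [norm_mul, Matrix.mulVec, dotProduct]
        refine (mul_le_mul_of_nonneg_left (norm_sum_le _ _) (norm_nonneg _)).trans_eq ?_
        rw [Finset.mul_sum]
        refine Finset.sum_congr rfl fun l _ => ?_
        have h1 := conductance_nonneg (f := f) k l
        rw [norm_mul, walkMatrix, Matrix.of_apply, Complex.norm_real, Real.norm_of_nonneg
          (by positivity), Pi.star_apply, norm_star, hh]
        ring
    _ ≤ ∑ k : Fin w, ∑ l : Fin w, (conductance f k l * h k ^ 2 + conductance f k l * h l ^ 2) / 2 := by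
        refine Finset.sum_le_sum fun k _ => Finset.sum_le_sum fun l _ => ?_
        have h1 := conductance_nonneg (f := f) k l
        nlinarith [mul_nonneg h1 (sq_nonneg (h k - h l))]
    _ = ∑ k : Fin w, ∑ l : Fin w, conductance f k l * h k ^ 2 := by
        have hswap : ∑ k : Fin w, ∑ l : Fin w, conductance f k l * h l ^ 2
            = ∑ k : Fin w, ∑ l : Fin w, conductance f k l * h k ^ 2 := by
          rw [Finset.sum_comm]
          exact Finset.sum_congr rfl fun k _ => Finset.sum_congr rfl fun l _ => by
            rw [conductance_comm]
        simp only [← Finset.sum_div, Finset.sum_add_distrib]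
        rw [hswap]
        ring
    _ = ∑ k, ‖u k‖ ^ 2 := by
        refine Finset.sum_congr rfl fun k _ => ?_
        rw [← Finset.sum_mul, sum_conductance h0 hw, hu]

theorem abs_eigenvalues_walkMatrix_le_one (h0 : f 0 = 0) (hw : f w = 0)
    (hpos : ∀ k < w, 0 < pathWeight f k) (j : Fin w) :
    |(walkMatrix_isHermitian f w).eigenvalues j| ≤ 1 := by
  have h := abs_reInner_walkMatrix_le h0 hw hpos
    ((walkMatrix_isHermitian f w).eigenvectorBasis j) |>.trans_eq
    (EuclideanSpace.norm_sq_eq _).symm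
  rw [OrthonormalBasis.norm_eq_one, one_pow] at h
  rw [Matrix.IsHermitian.eigenvalues_eq]
  exact h

variable (f w) in
/-- The square root of the normalized reversible measure. -/
noncomputable def walkState (k : Fin w) : ℝ :=
  √(pathWeight f k) / √(∑ l : Fin w, pathWeight f l)

theorem sum_walkState_sq [NeZero w] (hpos : ∀ k < w, 0 < pathWeight f k) :
    ∑ k, walkState f w k ^ 2 = 1 := by
  have hZ : 0 < ∑ l : Fin w, pathWeight f l :=
    Finset.sum_pos (fun l _ => hpos l l.2) Finset.univ_nonempty
  simp only [walkState, div_pow, Real.sq_sqrt (pathWeight_nonneg _), Real.sq_sqrt hZ.le]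
  rw [← Finset.sum_div, div_self hZ.ne']

/-- One step of the walk averages over the neighbours. -/
theorem sum_walkMatrix_smul {E : Type*} [AddCommGroup E] [Module ℂ E] (h0 : f 0 = 0)
    (hw : f w = 0) (hpos : ∀ k < w, 0 < pathWeight f k) (g : ℕ → E) (k : Fin w) :
    ∑ l : Fin w, walkMatrix f w k l • (walkState f w l : ℂ) • g (l + 1) =
      (walkState f w k : ℂ) • (((f (k + 1) ^ 2 / pathWeight f k : ℝ) : ℂ) • g (k + 2)
        + ((f k ^ 2 / pathWeight f k : ℝ) : ℂ) • g k) := by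
  let _ : Module ℝ E := Module.complexToReal E
  set Z := ∑ l : Fin w, pathWeight f l with hZ
  have h1 : ∀ l : Fin w, walkMatrix f w k l • (walkState f w l : ℂ) • g (l + 1) =
      ((√(pathWeight f k) * √Z)⁻¹ : ℝ) • conductance f k l • g (l + 1) := by
    intro l
    have hl := Real.sqrt_pos.2 (hpos l l.2)
    rw [← Complex.coe_smul, ← Complex.coe_smul, smul_smul, smul_smul, walkMatrix, walkState,
      Matrix.of_apply]
    congr 1
    norm_cast
    rw [← hZ]
    field_simp
  have hk := hpos k k.2
  have hk' := Real.sqrt_pos.2 hk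
  have h2 : ∀ x : ℝ, (√(pathWeight f k) * √Z)⁻¹ * x = walkState f w k * (x / pathWeight f k) := by
    intro x
    rw [walkState, ← hZ]
    nth_rewrite 3 [← Real.mul_self_sqrt hk.le]
    field_simp
  rw [Finset.sum_congr rfl fun l _ => h1 l, ← Finset.smul_sum, sum_conductance_smul h0 hw g k.2,
    smul_add, smul_add, smul_smul, smul_smul, h2, h2]
  simp only [← Complex.coe_smul, smul_smul]
  push_cast
  rfl

/-- Since f_{k+1}² - f_k² = (f_{k+1} - f_k)(f_{k+1} + f_k), the Lipschitz condition bounds its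
square by 2(f_{k+1}² + f_k²). The weight of the site cancels, and each site contributes at most 2
over the total weight. -/
theorem sum_walkState_sq_mul_drift_sq_le (hpos : ∀ k < w, 0 < pathWeight f k)
    (hlip : ∀ k, |f (k + 1) - f k| ≤ 1) :
    ∑ k : Fin w, walkState f w k ^ 2 *
      (f (k + 1) ^ 2 / pathWeight f k - f k ^ 2 / pathWeight f k) ^ 2 ≤
      2 * w / ∑ l : Fin w, pathWeight f l := by
  have hZ : 0 ≤ ∑ l : Fin w, pathWeight f l :=
    Finset.sum_nonneg fun l _ => pathWeight_nonneg _
  have h : ∀ k : Fin w, walkState f w k ^ 2 *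
      (f (k + 1) ^ 2 / pathWeight f k - f k ^ 2 / pathWeight f k) ^ 2 ≤
        2 / ∑ l : Fin w, pathWeight f l := by
    intro k
    have hk := hpos k k.2
    rw [walkState, div_pow, Real.sq_sqrt hk.le, Real.sq_sqrt hZ, div_mul_eq_mul_div]
    gcongr
    have h1 : (f (k + 1) - f k) ^ 2 ≤ 1 := (sq_le_one_iff_abs_le_one _).2 (hlip k)
    rw [← sub_div, div_pow, ← mul_div_assoc, div_le_iff₀ (by positivity)]
    have h2 : (f (k + 1) ^ 2 - f k ^ 2) ^ 2 ≤ 2 * pathWeight f k := by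
      have h3 : (f (k + 1) ^ 2 - f k ^ 2) ^ 2
          = (f (k + 1) - f k) ^ 2 * (f (k + 1) + f k) ^ 2 := by ring
      rw [h3, pathWeight]
      nlinarith [mul_le_mul_of_nonneg_right h1 (sq_nonneg (f (k + 1) + f k)),
        sq_nonneg (f (k + 1) - f k)]
    nlinarith
  calc _ ≤ ∑ _k : Fin w, 2 / ∑ l : Fin w, pathWeight f l := Finset.sum_le_sum fun k _ => h k
    _ = _ := by
      rw [Finset.sum_const, Finset.card_univ, Fintype.card_fin, nsmul_eq_mul]
      ring

end Walk

/-- The tent function on `{0, …, w}`. -/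
def tent (w k : ℕ) : ℝ := (min k (w - k) : ℕ)

theorem tent_zero (w : ℕ) : tent w 0 = 0 := by simp [tent]

theorem tent_self (w : ℕ) : tent w w = 0 := by simp [tent]

theorem abs_tent_succ_sub_le (w k : ℕ) : |tent w (k + 1) - tent w k| ≤ 1 := by
  have h1 : min (k + 1) (w - (k + 1)) ≤ min k (w - k) + 1 := by omega
  have h2 : min k (w - k) ≤ min (k + 1) (w - (k + 1)) + 1 := by omega
  unfold tent
  rify at h1 h2
  rw [abs_le]
  push_cast
  constructor <;> linarith

theorem pathWeight_tent_pos {w k : ℕ} (hw : 2 ≤ w) (hk : k < w) : 0 < pathWeight (tent w) k := by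
  unfold pathWeight
  rcases Nat.eq_zero_or_pos k with rfl | hk0
  · have : 0 < tent w (0 + 1) := Nat.cast_pos.2 (by omega)
    positivity
  · have : 0 < tent w k := Nat.cast_pos.2 (by omega)
    positivity

/-- The 2m sites of the middle half have height at least m. Cubic total weight against linear length
makes the mean squared drift O(1/m²). -/
theorem le_sum_pathWeight_tent (m : ℕ) :
    2 * (m : ℝ) ^ 3 ≤ ∑ k : Fin (4 * m), pathWeight (tent (4 * m)) k := by
  rw [Fin.sum_univ_eq_sum_range fun k => pathWeight (tent (4 * m)) k]
  calc 2 * (m : ℝ) ^ 3 = ∑ _k ∈ Finset.Ico m (3 * m), (m : ℝ) ^ 2 := by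
        rw [Finset.sum_const, Nat.card_Ico, nsmul_eq_mul, show 3 * m - m = 2 * m by omega]
        push_cast
        ring
    _ ≤ ∑ k ∈ Finset.Ico m (3 * m), pathWeight (tent (4 * m)) k := by
        refine Finset.sum_le_sum fun k hk => ?_
        rw [Finset.mem_Ico] at hk
        have h : (m : ℝ) ≤ tent (4 * m) k := Nat.cast_le.2 (by omega)
        have : (m : ℝ) ^ 2 ≤ tent (4 * m) k ^ 2 := by gcongr
        unfold pathWeight
        nlinarith [sq_nonneg (tent (4 * m) (k + 1))]
    _ ≤ _ := by
        refine Finset.sum_le_sum_of_subset_of_nonneg (fun k hk => ?_)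
          fun k _ _ => pathWeight_nonneg k
        rw [Finset.mem_Ico] at hk
        exact Finset.mem_range.2 (by omega)

/-! ### Unitaries on the workspace -/

/-- Extend the unit vector c to an orthonormal basis and use it as the columns. -/
theorem exists_unitary_first_column {w : ℕ} (c : Fin (w + 1) → ℂ) (hc : ∑ k, ‖c k‖ ^ 2 = 1) :
    ∃ S ∈ Matrix.unitaryGroup (Fin (w + 1)) ℂ, ∀ k, S k 0 = c k := by
  have horth : Orthonormal ℂ
      (({0} : Set (Fin (w + 1))).domRestrict fun _ => (WithLp.toLp 2 c :
        EuclideanSpace ℂ (Fin (w + 1)))) := by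
    constructor
    · intro i
      simp [EuclideanSpace.norm_eq, hc]
    · intro i j hij
      exact absurd (Subsingleton.elim i j) hij
  obtain ⟨b, hb⟩ := horth.exists_orthonormalBasis_extension_of_card_eq (by simp)
  refine ⟨_, (EuclideanSpace.basisFun (Fin (w + 1)) ℂ).toMatrix_orthonormalBasis_mem_unitary b,
    fun k => ?_⟩
  simp [Module.Basis.toMatrix_apply, hb 0 rfl]

/-- A unitary on the workspace. -/
noncomputable def onWorkspace (n : ℕ) {w : ℕ} (S : Matrix.unitaryGroup (Fin w) ℂ) :
    Matrix.unitaryGroup (Fin n × Fin w) ℂ :=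
  ⟨Matrix.kroneckerMap (· * ·) 1 S.1, Matrix.kronecker_mem_unitary (one_mem _) S.2⟩

/-- The joint state with branch `u k` in the first register when the workspace is in state `k`. -/
def ofBranches {n w : ℕ} (u : Fin w → Fin n → ℂ) : Fin n × Fin w → ℂ := fun p => u p.2 p.1

theorem onWorkspace_mulVec {n w : ℕ} (S : Matrix.unitaryGroup (Fin w) ℂ) (u : Fin w → Fin n → ℂ) :
    (onWorkspace n S).1.mulVec (ofBranches u) =
      fun p => (S : Matrix (Fin w) (Fin w) ℂ).mulVec (fun k => u k p.1) p.2 := by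
  funext p
  simp only [onWorkspace, Matrix.mulVec, dotProduct, Fintype.sum_prod_type, ofBranches,
    Matrix.kroneckerMap_apply]
  rw [Finset.sum_eq_single p.1]
  · simp
  · intro b _ hb
    simp [Matrix.one_apply_ne hb.symm]
  · simp

theorem onWorkspace_mulVec_single {n w : ℕ} (S : Matrix.unitaryGroup (Fin w) ℂ) (i : Fin n)
    (j : Fin w) :
    (onWorkspace n S).1.mulVec (Pi.single (i, j) 1) =
      ofBranches fun k => S.1 k j • (Pi.single i 1 : Fin n → ℂ) := by
  funext p
  rw [Matrix.mulVec_single_one]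
  simp [onWorkspace, ofBranches, Matrix.col, Matrix.one_apply, Pi.single_apply, mul_comm]

theorem controlled_mulVec {n w : ℕ} (c : Finset (Fin w)) (M : Matrix (Fin n) (Fin n) ℂ)
    (u : Fin w → Fin n → ℂ) :
    (controlled c M).mulVec (ofBranches u) =
      ofBranches fun k => if k ∈ c then M.mulVec (u k) else u k := by
  funext p
  simp only [controlled, Matrix.mulVec, dotProduct, Fintype.sum_prod_type, ofBranches,
    Matrix.blockDiagonal_apply]
  simp only [ite_mul, zero_mul, Finset.sum_ite_eq, Finset.mem_univ, if_true]
  split_ifs with h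
  · rfl
  · simp [Matrix.one_apply]

/-! ### Controlled powers of the Grover operator -/

section Ladder

variable {n w : ℕ} [NeZero n]

/-- One Grover operator, controlled on the workspace. -/
noncomputable def groverSteps (n : ℕ) [NeZero n] {w : ℕ} (c : Finset (Fin w)) :
    List (Query × Finset (Fin w) × Matrix.unitaryGroup (Fin n × Fin w) ℂ) :=
  [(.reflect, c, 1), (.prepInv, c, ⟨controlled c (zeroReflection n),
    controlled_mem c zeroReflection_mem⟩), (.prep, c, 1)]

/-- The zero reflection is controlled along with the oracle calls, so branches outside `c` are left
unchanged. -/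
theorem runSteps_groverSteps (I : Instance n) (c : Finset (Fin w)) (u : Fin w → Fin n → ℂ) :
    QueryAlg.runSteps I (ofBranches u) (groverSteps n c) =
      ofBranches fun k => if k ∈ c then I.grover.mulVec (u k) else u k := by
  simp only [QueryAlg.runSteps, groverSteps, List.foldl_cons, List.foldl_nil, controlled_mulVec,
    OneMemClass.coe_one, Matrix.one_mulVec]
  congr 1
  funext k
  split_ifs with h
  · simp [Instance.grover, Matrix.mulVec_mulVec]
  · rfl

/-- The `k`-th branch undergoes `min j (k + 1)` Grover operators. -/
noncomputable def ladder (n w : ℕ) [NeZero n] (j : ℕ) :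
    List (Query × Finset (Fin w) × Matrix.unitaryGroup (Fin n × Fin w) ℂ) :=
  (List.range j).flatMap fun i => groverSteps n (Finset.univ.filter fun k : Fin w => i ≤ (k : ℕ))

theorem length_ladder (j : ℕ) : (ladder n w j).length = 3 * j := by
  induction j with
  | zero => simp [ladder]
  | succ j ih =>
    rw [ladder, List.range_succ, List.flatMap_append, List.length_append, ← ladder, ih]
    simp [groverSteps]
    ring

/-- Rung i acts only on branches k ≥ i, so branch k stops advancing after rung k. All powers of G
are thus produced in superposition at the cost of the largest one. -/
theorem runSteps_ladder (I : Instance n) (a : Fin w → ℂ) (j : ℕ) :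
    QueryAlg.runSteps I (ofBranches fun k => a k • I.state) (ladder n w j) =
      ofBranches fun k => a k • I.orbit (min j (k + 1)) := by
  induction j with
  | zero => simp [ladder, QueryAlg.runSteps, Instance.orbit]
  | succ j ih =>
    rw [ladder, List.range_succ, List.flatMap_append, QueryAlg.runSteps, List.foldl_append,
      ← QueryAlg.runSteps, ← QueryAlg.runSteps, ← ladder, ih, List.flatMap_singleton,
      runSteps_groverSteps]
    congr 1
    funext k
    split_ifs with h
    · have h' : j ≤ (k : ℕ) := by simpa using h
      rw [Matrix.mulVec_smul, I.grover_mulVec_orbit, min_eq_left (by omega), min_eq_left (by omega)]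
    · have h' : ¬ j ≤ (k : ℕ) := by simpa using h
      rw [min_eq_right (by omega), min_eq_right (by omega)]

end Ladder

/-! ### The first two moments of a spectral measurement -/

/-- In the eigenbasis H multiplies coordinates by its eigenvalues, and the change of basis preserves
inner products. Thus the outcome moments need no knowledge of the spectrum. -/
theorem sum_eigenvalues_mul_norm_sq {ι : Type*} [Fintype ι] [DecidableEq ι] {H : Matrix ι ι ℂ}
    (hH : H.IsHermitian) (u : ι → ℂ) :
    ∑ j, hH.eigenvalues j * ‖(star (hH.eigenvectorUnitary : Matrix ι ι ℂ)).mulVec u j‖ ^ 2 =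
        reInner u (H.mulVec u) ∧
      ∑ j, hH.eigenvalues j ^ 2 *
          ‖(star (hH.eigenvectorUnitary : Matrix ι ι ℂ)).mulVec u j‖ ^ 2 =
        reInner (H.mulVec u) (H.mulVec u) := by
  set W : Matrix ι ι ℂ := (hH.eigenvectorUnitary : Matrix ι ι ℂ) with hW
  have hWs : star W ∈ Matrix.unitaryGroup ι ℂ := (star hH.eigenvectorUnitary).2
  have hWW : star W * W = 1 := Matrix.mem_unitaryGroup_iff'.1 hH.eigenvectorUnitary.2
  have hdiag : ∀ j, (star W).mulVec (H.mulVec u) j =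
      (hH.eigenvalues j : ℂ) * (star W).mulVec u j := by
    intro j
    conv_lhs => rw [hH.spectral_theorem]
    rw [Unitary.conjStarAlgAut_apply, ← hW, Matrix.mulVec_mulVec, ← mul_assoc, ← mul_assoc, hWW,
      one_mul, ← Matrix.mulVec_mulVec, Matrix.mulVec_diagonal]
    rfl
  constructor
  · rw [← reInner_mulVec_unitary hWs, reInner, dotProduct, Complex.re_sum]
    refine Finset.sum_congr rfl fun j _ => ?_
    rw [hdiag, Pi.star_apply, RCLike.star_def, mul_left_comm, Complex.conj_mul']
    norm_cast
  · rw [← reInner_mulVec_unitary hWs, reInner_self]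
    refine Finset.sum_congr rfl fun j _ => ?_
    rw [hdiag, norm_mul, mul_pow, Complex.norm_real, Real.norm_eq_abs, sq_abs]

theorem sum_reInner_branches {n w : ℕ} (u v : Fin w → Fin n → ℂ) :
    ∑ x, reInner (fun k => u k x) (fun k => v k x) = ∑ k, reInner (u k) (v k) := by
  simp only [reInner, dotProduct, Complex.re_sum]
  exact Finset.sum_comm

/-! ### The law of the output -/

theorem QueryAlg.isProbabilityMeasure_law {n : ℕ} [NeZero n] (𝒜 : QueryAlg n) (I : Instance n) :
    IsProbabilityMeasure (𝒜.law I) := by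
  unfold QueryAlg.law
  infer_instance

theorem QueryAlg.law_eq_map {n : ℕ} [NeZero n] (𝒜 : QueryAlg n) (I : Instance n) :
    𝒜.law I = (𝒜.outcome I).toMeasure.map 𝒜.output := by
  rw [PMF.toMeasure_map _ _ (measurable_of_countable _)]
  rfl

theorem QueryAlg.integral_law {n : ℕ} [NeZero n] (𝒜 : QueryAlg n) (I : Instance n) {g : ℝ → ℝ}
    (hg : Measurable g) :
    ∫ y, g y ∂𝒜.law I = ∑ p, g (𝒜.output p) * ‖𝒜.finalState I p‖ ^ 2 := by
  rw [𝒜.law_eq_map, integral_map (measurable_of_countable _).aemeasurable hg.aestronglyMeasurable,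
    PMF.integral_eq_sum]
  refine Finset.sum_congr rfl fun p _ => ?_
  rw [QueryAlg.outcome, PMF.ofFintype_apply, ENNReal.toReal_ofReal (by positivity), smul_eq_mul,
    mul_comm]

theorem QueryAlg.ae_law {n : ℕ} [NeZero n] (𝒜 : QueryAlg n) (I : Instance n) {s : Set ℝ}
    (hs : MeasurableSet s) (h : ∀ p, 𝒜.output p ∈ s) : ∀ᵐ y ∂𝒜.law I, y ∈ s := by
  rw [𝒜.law_eq_map]
  refine (ae_map_iff (measurable_of_countable _).aemeasurable hs).2 ?_
  exact Filter.Eventually.of_forall h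

/-! ### Measuring a superposition of Grover iterates -/

section OrbitAlg

variable (n : ℕ) [NeZero n] {r : ℕ} {c : Fin (r + 1) → ℝ} (hc : ∑ k, ‖(c k : ℂ)‖ ^ 2 = 1)
  {H : Matrix (Fin (r + 1)) (Fin (r + 1)) ℂ} (hH : H.IsHermitian)

/-- Prepare `∑ k, c k |k⟩`, apply `k + 1` Grover operators controlled on `|k⟩`, measure the
observable `H` on the workspace, and return `(1 - λ) / 2` for the outcome `λ`. -/
noncomputable def orbitAlg : QueryAlg n where
  ancilla := r
  start := onWorkspace n ⟨_, (exists_unitary_first_column _ hc).choose_spec.1⟩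
  -- The first call prepares ψ in every branch. The last has empty control, hence acts trivially: it
  -- only carries the change to the eigenbasis of `H`, since every later unitary is attached to a
  -- call.
  steps := (.prep, Finset.univ, 1) :: (ladder n (r + 1) (r + 1) ++
    [(.prep, ∅, onWorkspace n (star hH.eigenvectorUnitary))])
  output p := (1 - hH.eigenvalues p.2) / 2

theorem queries_orbitAlg : (orbitAlg n hc hH).queries = 3 * r + 5 := by
  calc (orbitAlg n hc hH).queries = (ladder n (r + 1) (r + 1)).length + 1 + 1 :=
        congrArg (· + 1) List.length_append
    _ = 3 * r + 5 := by
        rw [length_ladder]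
        ring

variable {n}

theorem finalState_orbitAlg (I : Instance n) (p : Fin n × Fin (r + 1)) :
    (orbitAlg n hc hH).finalState I p =
      (star (hH.eigenvectorUnitary : Matrix (Fin (r + 1)) (Fin (r + 1)) ℂ)).mulVec
        (fun k => ((c k : ℂ) • I.orbit (k + 1)) p.1) p.2 := by
  set S : Matrix.unitaryGroup (Fin (r + 1)) ℂ :=
    ⟨_, (exists_unitary_first_column _ hc).choose_spec.1⟩
  have hS : ∀ k, S.1 k 0 = c k := (exists_unitary_first_column _ hc).choose_spec.2
  have hstart : (controlled Finset.univ (I.oracle .prep)).mulVec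
      ((onWorkspace n S).1.mulVec (Pi.single (0, 0) 1)) =
      ofBranches fun k => (c k : ℂ) • I.state := by
    rw [onWorkspace_mulVec_single, controlled_mulVec]
    simp only [hS, Finset.mem_univ, if_true, Matrix.mulVec_smul]
    rfl
  have hlad := runSteps_ladder I (fun k => (c k : ℂ)) (r + 1)
  change QueryAlg.runSteps I ((onWorkspace n S).1.mulVec (Pi.single (0, 0) 1))
    ((.prep, Finset.univ, 1) :: (ladder n (r + 1) (r + 1) ++
      [(.prep, ∅, onWorkspace n (star hH.eigenvectorUnitary))])) p = _
  rw [QueryAlg.runSteps] at hlad ⊢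
  rw [List.foldl_cons, List.foldl_append, OneMemClass.coe_one, Matrix.one_mulVec, hstart, hlad,
    List.foldl_cons, List.foldl_nil, controlled_mulVec]
  simp only [Finset.notMem_empty, if_false]
  rw [onWorkspace_mulVec]
  simp only [min_eq_right (Nat.succ_le_of_lt (Fin.is_lt _))]
  rfl

/-- `H` acts on the workspace alone, so the moment formulas hold for each basis state of the first
register and are summed over it. Here `v` is the family of branches after applying `H`. -/
theorem moments_orbitAlg (I : Instance n) (v : Fin (r + 1) → Fin n → ℂ)
    (hv : ∀ k, ∑ l, H k l • (c l : ℂ) • I.orbit (l + 1) = v k) :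
    ∑ p : Fin n × Fin (r + 1), hH.eigenvalues p.2 * ‖(orbitAlg n hc hH).finalState I p‖ ^ 2 =
        ∑ k, reInner ((c k : ℂ) • I.orbit (k + 1)) (v k) ∧
      ∑ p : Fin n × Fin (r + 1),
          hH.eigenvalues p.2 ^ 2 * ‖(orbitAlg n hc hH).finalState I p‖ ^ 2 =
        ∑ k, reInner (v k) (v k) := by
  have hv' : ∀ x, H.mulVec (fun k => ((c k : ℂ) • I.orbit (k + 1)) x) = fun k => v k x := by
    intro x
    funext k
    rw [← hv, Finset.sum_apply]
    rfl
  have h := fun x => sum_eigenvalues_mul_norm_sq hH fun k => ((c k : ℂ) • I.orbit (k + 1)) x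
  simp only [hv'] at h
  simp only [Fintype.sum_prod_type, finalState_orbitAlg, (h _).1, (h _).2]
  exact ⟨sum_reInner_branches _ _, sum_reInner_branches _ _⟩

theorem mean_variance_orbitAlg (I : Instance n) {C s : ℝ}
    (h1 : ∑ p : Fin n × Fin (r + 1),
      hH.eigenvalues p.2 * ‖(orbitAlg n hc hH).finalState I p‖ ^ 2 = C)
    (h2 : ∑ p : Fin n × Fin (r + 1),
      hH.eigenvalues p.2 ^ 2 * ‖(orbitAlg n hc hH).finalState I p‖ ^ 2 = C ^ 2 + s)
    (hbd : ∀ j, |hH.eigenvalues j| ≤ 1) :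
    (∀ᵐ y ∂(orbitAlg n hc hH).law I, y ∈ Set.Icc (0 : ℝ) 1) ∧
      ∫ y, y ∂(orbitAlg n hc hH).law I = (1 - C) / 2 ∧
      variance (fun y : ℝ => y) ((orbitAlg n hc hH).law I) = s / 4 := by
  have hmem : ∀ᵐ y ∂(orbitAlg n hc hH).law I, y ∈ Set.Icc (0 : ℝ) 1 := by
    refine QueryAlg.ae_law _ I measurableSet_Icc fun p => ?_
    have := abs_le.1 (hbd p.2)
    change (1 - hH.eigenvalues p.2) / 2 ∈ Set.Icc (0 : ℝ) 1
    constructor <;> linarith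
  have h0 : ∑ p : Fin n × Fin (r + 1), ‖(orbitAlg n hc hH).finalState I p‖ ^ 2 = 1 :=
    QueryAlg.sum_norm_sq_finalState (orbitAlg n hc hH) I
  have hmean : ∫ y, y ∂(orbitAlg n hc hH).law I = (1 - C) / 2 := by
    rw [QueryAlg.integral_law _ I (g := fun y => y) measurable_id, ← h1, ← h0,
      ← Finset.sum_sub_distrib, Finset.sum_div]
    refine Finset.sum_congr rfl fun p _ => ?_
    change (1 - hH.eigenvalues p.2) / 2 * _ = _
    ring
  have hsq : ∫ y, y ^ 2 ∂(orbitAlg n hc hH).law I = (1 - 2 * C + (C ^ 2 + s)) / 4 := by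
    rw [QueryAlg.integral_law _ I (g := fun y => y ^ 2) (by fun_prop), ← h2, ← h1, ← h0,
      Finset.mul_sum, ← Finset.sum_sub_distrib, ← Finset.sum_add_distrib, Finset.sum_div]
    refine Finset.sum_congr rfl fun p _ => ?_
    change ((1 - hH.eigenvalues p.2) / 2) ^ 2 * _ = _
    ring
  refine ⟨hmem, hmean, ?_⟩
  have := (orbitAlg n hc hH).isProbabilityMeasure_law I
  have hL : MemLp (fun y : ℝ => y) 2 ((orbitAlg n hc hH).law I) :=
    MemLp.of_bound measurable_id.aestronglyMeasurable 1 (by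
      filter_upwards [hmem] with y hy
      rw [Real.norm_eq_abs, abs_le]
      exact ⟨by linarith [hy.1], hy.2⟩)
  rw [variance_eq_sub hL]
  simp only [Pi.pow_apply]
  rw [hsq, hmean]
  ring

end OrbitAlg

/-! ### The unbiased estimator -/

section WalkAlg

variable {n : ℕ} [NeZero n] {r : ℕ} {f : ℕ → ℝ}

/-- Every branch contributes the same inner product C, so the mean does not depend on f. Only the
drift p_k - q_k enters the variance, with 1 - C² = 4a(1 - a) and a factor 1/4 from λ ↦ (1 - λ)/2. -/
theorem mean_variance_walk (hc : ∑ k, ‖(walkState f (r + 1) k : ℂ)‖ ^ 2 = 1) (h0 : f 0 = 0)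
    (hr : f (r + 1) = 0) (hpos : ∀ k < r + 1, 0 < pathWeight f k) (I : Instance n) :
    (∀ᵐ y ∂(orbitAlg n hc (walkMatrix_isHermitian f (r + 1))).law I, y ∈ Set.Icc (0 : ℝ) 1) ∧
      ∫ y, y ∂(orbitAlg n hc (walkMatrix_isHermitian f (r + 1))).law I = I.amplitude ∧
      variance (fun y : ℝ => y) ((orbitAlg n hc (walkMatrix_isHermitian f (r + 1))).law I) =
        I.amplitude * (1 - I.amplitude) * ∑ k : Fin (r + 1), walkState f (r + 1) k ^ 2 *
          (f (k + 1) ^ 2 / pathWeight f k - f k ^ 2 / pathWeight f k) ^ 2 := by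
  have hstep := fun k : Fin (r + 1) => reInner_neighbour_average
    (x := I.orbit k) (y := I.orbit (k + 1)) (z := I.orbit (k + 2)) (C := 1 - 2 * I.amplitude)
    (p := f (k + 1) ^ 2 / pathWeight f k) (q := f k ^ 2 / pathWeight f k)
    (by rw [← add_div]; exact div_self (hpos k k.2).ne') (I.orbit_add k) (I.reInner_orbit_self _)
    (I.reInner_orbit_self _) (I.reInner_orbit_self _) (I.reInner_orbit_succ _)
  obtain ⟨m1, m2⟩ := moments_orbitAlg hc (walkMatrix_isHermitian f (r + 1)) I _
    (sum_walkMatrix_smul h0 hr hpos I.orbit)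
  have hc' := sum_walkState_sq hpos
  simp only [reInner_smul_left, reInner_smul_right, (hstep _).1, (hstep _).2, ← mul_assoc,
    ← sq] at m1 m2
  rw [← Finset.sum_mul, hc', one_mul] at m1
  simp only [mul_add, Finset.sum_add_distrib, ← Finset.sum_mul, hc', one_mul, ← mul_assoc] at m2
  obtain ⟨h1, h2, h3⟩ := mean_variance_orbitAlg hc (walkMatrix_isHermitian f (r + 1)) I m1 m2
    (abs_eigenvalues_walkMatrix_le_one h0 hr hpos)
  refine ⟨h1, h2.trans (by ring), h3.trans (by ring)⟩

theorem sum_norm_sq_walkState_tent (m : ℕ) :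
    ∑ k, ‖(walkState (tent (4 * m + 3 + 1)) (4 * m + 3 + 1) k : ℂ)‖ ^ 2 = 1 := by
  rw [← sum_walkState_sq (f := tent (4 * m + 3 + 1)) (w := 4 * m + 3 + 1)
    fun k hk => pathWeight_tent_pos (by omega) hk]
  simp

end WalkAlg

/-- The walk estimator with path length proportional to `K`. -/
noncomputable def walkFamily : AlgFamily := fun n _ K _ =>
  -- The path has 4m sites with m = ⌈K⌉ + 1; the form 4⌈K⌉ + 3 + 1 matches a workspace of dimension
  -- `ancilla + 1`. The parameter B plays no role, as the bias is zero.
  orbitAlg n (sum_norm_sq_walkState_tent ⌈K⌉₊)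
    (walkMatrix_isHermitian (tent (4 * ⌈K⌉₊ + 3 + 1)) (4 * ⌈K⌉₊ + 3 + 1))

theorem walkFamily_mean_variance {n : ℕ} [NeZero n] {K : ℝ} (B : ℝ) (I : Instance n) :
    (∀ᵐ y ∂(walkFamily n K B).law I, y ∈ Set.Icc (0 : ℝ) 1) ∧
      ∫ y, y ∂(walkFamily n K B).law I = I.amplitude ∧
      variance (fun y : ℝ => y) ((walkFamily n K B).law I) =
        I.amplitude * (1 - I.amplitude) * ∑ k : Fin (4 * ⌈K⌉₊ + 3 + 1),
          walkState (tent (4 * ⌈K⌉₊ + 3 + 1)) (4 * ⌈K⌉₊ + 3 + 1) k ^ 2 *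
          (tent (4 * ⌈K⌉₊ + 3 + 1) (k + 1) ^ 2 / pathWeight (tent (4 * ⌈K⌉₊ + 3 + 1)) k -
            tent (4 * ⌈K⌉₊ + 3 + 1) k ^ 2 / pathWeight (tent (4 * ⌈K⌉₊ + 3 + 1)) k) ^ 2 :=
  mean_variance_walk (sum_norm_sq_walkState_tent ⌈K⌉₊) (tent_zero _) (tent_self _)
    (fun _ hk => pathWeight_tent_pos (by omega) hk) I

/-- With w = 4M and total weight at least 2M³, the drift bound 2w/(2M³) is 4/M², and M ≥ K. -/
theorem variance_walkFamily_le {n : ℕ} [NeZero n] {K : ℝ} (B : ℝ) (hK : 0 < K) (I : Instance n) :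
    variance (fun y : ℝ => y) ((walkFamily n K B).law I) ≤ 91 * I.amplitude / K ^ 2 := by
  have hpos : ∀ k < 4 * ⌈K⌉₊ + 3 + 1, 0 < pathWeight (tent (4 * ⌈K⌉₊ + 3 + 1)) k :=
    fun k hk => pathWeight_tent_pos (by omega) hk
  have hd := sum_walkState_sq_mul_drift_sq_le hpos (abs_tent_succ_sub_le _)
  have hZ := le_sum_pathWeight_tent (⌈K⌉₊ + 1)
  rw [show 4 * (⌈K⌉₊ + 1) = 4 * ⌈K⌉₊ + 3 + 1 by ring] at hZ
  have ha := I.amplitude_nonneg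
  have ha1 := I.amplitude_le_one
  have hKm : K ≤ ((⌈K⌉₊ + 1 : ℕ) : ℝ) := (Nat.le_ceil K).trans (by push_cast; linarith)
  set M : ℝ := ((⌈K⌉₊ + 1 : ℕ) : ℝ) with hM
  have hMpos : 0 < M := hK.trans_le hKm
  have hw : ((4 * ⌈K⌉₊ + 3 + 1 : ℕ) : ℝ) = 4 * M := by
    rw [hM]
    push_cast
    ring
  rw [(walkFamily_mean_variance B I).2.2]
  calc _ ≤ I.amplitude * 1 * (2 * ((4 * ⌈K⌉₊ + 3 + 1 : ℕ) : ℝ) / (2 * M ^ 3)) := by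
        gcongr
        · linarith
        · exact hd.trans (by gcongr)
    _ = 4 * I.amplitude / M ^ 2 := by
        rw [hw]
        field_simp
    _ ≤ 91 * I.amplitude / K ^ 2 := by
        gcongr
        norm_num

theorem log_log_nonneg_and_log_pos {K : ℝ} (hK : 4 ≤ K) :
    Real.log (Real.log 4) ≤ Real.log (Real.log K) ∧ 0 < Real.log (Real.log 4) ∧ 1 < Real.log 4 := by
  have h4 : 1 < Real.log 4 := by
    rw [show (4 : ℝ) = 2 ^ 2 by norm_num, Real.log_pow]
    have := Real.log_two_gt_d9
    push_cast
    linarith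
  exact ⟨Real.log_le_log (by linarith) (Real.log_le_log (by norm_num) hK), Real.log_pos h4, h4⟩

theorem isUnbiasedAE_walkFamily : IsUnbiasedAE walkFamily where
  mem_Icc n _ K B _ _ _ I := (walkFamily_mean_variance B I).1
  bias n _ K B _ hB _ I := by
    rw [(walkFamily_mean_variance B I).2.1, sub_self, abs_zero]
    exact hB.le
  variance n _ K B hK hB _ I :=
    (variance_walkFamily_le B (by linarith) I).trans (by linarith)
  queries := by
    -- There are 12⌈K⌉ + 14 ≤ 12K + 26 ≤ 19K calls, the last step using K ≥ 4. The logarithmic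
    -- factors in the allowed bound are bounded below by log log 4 and 1.
    refine ⟨19 / Real.log (Real.log 4), fun n _ K B hK hB hB1 => ?_⟩
    obtain ⟨h1, h2, h3⟩ := log_log_nonneg_and_log_pos hK
    have hq : (walkFamily n K B).queries = 3 * (4 * ⌈K⌉₊ + 3) + 5 := queries_orbitAlg ..
    have hceil := Nat.ceil_lt_add_one (by linarith : 0 ≤ K)
    have h4 : 1 ≤ Real.log (K / B) := by
      refine h3.le.trans (Real.log_le_log (by norm_num) ?_)
      rw [le_div_iff₀ hB]
      nlinarith
    rw [hq]
    push_cast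
    calc (3 * (4 * (⌈K⌉₊ : ℝ) + 3) + 5) ≤ 19 * K * 1 := by linarith
      _ ≤ 19 * K * Real.log (K / B) := by gcongr
      _ = 19 / Real.log (Real.log 4) * (K * Real.log (Real.log 4) * Real.log (K / B)) := by
          field_simp
      _ ≤ _ := by gcongr

/-! ### The sample mean of independent runs -/

/-- Chebyshev's inequality for the mean of i.i.d. bounded random variables with a bias. -/
theorem half_lt_measureReal_sampleMean {T : ℕ} (hT : T ≠ 0) {μ : Measure ℝ}
    [IsProbabilityMeasure μ] (hμ : ∀ᵐ y ∂μ, y ∈ Set.Icc (0 : ℝ) 1) {a ε : ℝ} (hε : 0 < ε)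
    (hbias : |(∫ y, y ∂μ) - a| ≤ 0.05 * ε)
    (hvar : variance (fun y : ℝ => y) μ ≤ 100 / 225 * ε ^ 2 * T) :
    1 / 2 < (Measure.pi fun _ : Fin T => μ).real {y | |sampleMean y - a| ≤ ε} := by
  have hT' : (T : ℝ) ≠ 0 := Nat.cast_ne_zero.2 hT
  have hTpos : (0 : ℝ) < T := by positivity
  have hL : MemLp (fun y : ℝ => y) 2 μ :=
    MemLp.of_bound measurable_id.aestronglyMeasurable 1 (by
      filter_upwards [hμ] with y hy
      rw [Real.norm_eq_abs, abs_le]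
      exact ⟨by linarith [hy.1], hy.2⟩)
  set ν := Measure.pi fun _ : Fin T => μ with hν
  have hLi : ∀ i : Fin T, MemLp (fun y : Fin T → ℝ => y i) 2 ν := fun i =>
    hL.comp_measurePreserving (measurePreserving_eval (fun _ : Fin T => μ) i)
  have hmean : sampleMean = fun y : Fin T → ℝ =>
      (T : ℝ)⁻¹ * (∑ i, fun y : Fin T → ℝ => y i) y := by
    funext y
    rw [sampleMean, Finset.sum_apply, div_eq_inv_mul]
  have hLs : MemLp (∑ i, fun y : Fin T → ℝ => y i) 2 ν := memLp_finsetSum' _ fun i _ => hLi i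
  have hLm : MemLp (sampleMean : (Fin T → ℝ) → ℝ) 2 ν := by
    rw [hmean]
    exact hLs.const_mul _
  have hint : ∫ y, sampleMean y ∂ν = ∫ y, y ∂μ := by
    rw [hmean, integral_const_mul]
    simp only [Finset.sum_apply]
    rw [integral_finsetSum _ fun i _ => (hLi i).integrable one_le_two]
    have : ∀ i : Fin T, ∫ y : Fin T → ℝ, y i ∂ν = ∫ y, y ∂μ := fun i =>
      integral_comp_eval (μ := fun _ : Fin T => μ) (f := fun y : ℝ => y)
        measurable_id.aestronglyMeasurable
    simp [this, hT']
  have hvm : variance (sampleMean : (Fin T → ℝ) → ℝ) ν ≤ 100 / 225 * ε ^ 2 := by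
    rw [hmean, variance_const_mul, hν,
      variance_sum_pi (μ := fun _ : Fin T => μ) (X := fun _ y => y) fun _ => hL]
    simp only [Finset.sum_const, Finset.card_univ, Fintype.card_fin, nsmul_eq_mul]
    calc ((T : ℝ)⁻¹) ^ 2 * (T * variance (fun y : ℝ => y) μ)
        = (T : ℝ)⁻¹ * variance (fun y : ℝ => y) μ := by field_simp
      _ ≤ (T : ℝ)⁻¹ * (100 / 225 * ε ^ 2 * T) := by gcongr
      _ = 100 / 225 * ε ^ 2 := by field_simp
  -- The bias uses up 0.05 ε of the tolerance, so an error above ε forces a deviation of at least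
  -- 0.95 ε from the true mean.
  have hc : (0 : ℝ) < 0.95 * ε := by positivity
  have hcheb := meas_ge_le_variance_div_sq hLm hc
  rw [hint] at hcheb
  have hmeas : Measurable (sampleMean : (Fin T → ℝ) → ℝ) := by
    unfold sampleMean
    fun_prop
  have hbad : ν.real {y | |sampleMean y - a| ≤ ε}ᶜ ≤ 100 / 225 / 0.95 ^ 2 := by
    have hsub : {y : Fin T → ℝ | |sampleMean y - a| ≤ ε}ᶜ ⊆
        {y | 0.95 * ε ≤ |sampleMean y - ∫ y, y ∂μ|} := by
      intro y hy
      simp only [Set.mem_compl_iff, Set.mem_ofPred_eq, not_le] at hy ⊢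
      have := abs_sub_le (sampleMean y) (∫ y, y ∂μ) a
      linarith
    have h1 : ν {y | |sampleMean y - a| ≤ ε}ᶜ ≤ ENNReal.ofReal (100 / 225 / 0.95 ^ 2) := by
      refine (measure_mono hsub).trans (hcheb.trans (ENNReal.ofReal_le_ofReal ?_))
      rw [div_le_iff₀ (by positivity)]
      calc _ ≤ 100 / 225 * ε ^ 2 := hvm
        _ = _ := by ring
    rw [Measure.real]
    exact ENNReal.toReal_le_of_le_ofReal (by norm_num) h1
  have hS : MeasurableSet {y : Fin T → ℝ | |sampleMean y - a| ≤ ε} :=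
    measurableSet_le (by fun_prop) measurable_const
  have := probReal_compl_eq_one_sub (μ := ν) hS
  -- The failure bound (100/225)/0.95² is about 0.492.
  norm_num at hbad
  linarith

/-! ### The parameters -/

theorem four_le_paramK {ε β : ℝ} (hε : 0 < ε) (hε1 : ε ≤ 1) (hβ : β ≤ 1) : 4 ≤ paramK ε β := by
  have : 1 ≤ ε ^ (-1 + β) := Real.one_le_rpow_of_pos_of_le_one_of_nonpos hε hε1 (by linarith)
  unfold paramK
  linarith

theorem paramB_pos {ε β : ℝ} (hε : 0 < ε) : 0 < paramB ε β := by
  unfold paramB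
  positivity

theorem paramB_lt_one {ε β : ℝ} (hε1 : ε ≤ 1) : paramB ε β < 1 :=
  (min_le_right _ _).trans_lt (by linarith)

theorem paramT_ne_zero {ε β : ℝ} (hε : 0 < ε) : paramT ε β ≠ 0 :=
  (Nat.ceil_pos.2 (Real.rpow_pos_of_pos hε _)).ne'

theorem IsUnbiasedAE.half_lt_parallelLaw {F : AlgFamily} (hF : IsUnbiasedAE F) {ε β : ℝ}
    (hε : 0 < ε) (hε1 : ε < 1) (hβ1 : β ≤ 1) {n : ℕ} [NeZero n] (I : Instance n) :
    1 / 2 < (parallelLaw (lowDepthRuns F n ε β) I).real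
      {y | |sampleMean y - I.amplitude| ≤ ε} := by
  have hK := four_le_paramK hε hε1.le hβ1
  have hB := paramB_pos (β := β) hε
  have hB1 := paramB_lt_one (β := β) hε1.le
  have := (F n (paramK ε β) (paramB ε β)).isProbabilityMeasure_law I
  refine half_lt_measureReal_sampleMean (paramT_ne_zero hε) (hF.mem_Icc n _ _ hK hB hB1 I) hε
    ((hF.bias n _ _ hK hB hB1 I).trans (min_le_right _ _))
    ((hF.variance n _ _ hK hB hB1 I).trans ?_)
  have hKsq : paramK ε β ^ 2 = 225 / ε ^ (2 - 2 * β) := by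
    rw [paramK, mul_pow, ← Real.rpow_natCast (ε ^ (-1 + β)), ← Real.rpow_mul hε.le,
      div_eq_mul_inv, ← Real.rpow_neg hε.le]
    congr 1
    · norm_num
    · congr 1
      push_cast
      ring
  have hpos : 0 < ε ^ (2 - 2 * β) := Real.rpow_pos_of_pos hε _
  have hBle : paramB ε β ≤ 9 / 225 * ε ^ (2 - 2 * β) := min_le_left _ _
  have hT : ε ^ (-2 * β) ≤ paramT ε β := Nat.le_ceil _
  have hε2 : ε ^ 2 * ε ^ (-2 * β) = ε ^ (2 - 2 * β) := by
    rw [← Real.rpow_natCast ε 2, ← Real.rpow_add hε]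
    congr 1
    push_cast
    ring
  -- The constants fit as 15² = 225 and 91 + 9 = 100; the factor ε^(-2β) is absorbed by T.
  calc 91 * I.amplitude / paramK ε β ^ 2 + paramB ε β
      = 91 / 225 * ε ^ (2 - 2 * β) * I.amplitude + paramB ε β := by
        rw [hKsq]
        field_simp
    _ ≤ 91 / 225 * ε ^ (2 - 2 * β) * 1 + 9 / 225 * ε ^ (2 - 2 * β) := by
        gcongr
        exact I.amplitude_le_one
    _ = 100 / 225 * ε ^ 2 * ε ^ (-2 * β) := by rw [mul_assoc (100 / 225 : ℝ), hε2]; ring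
    _ ≤ 100 / 225 * ε ^ 2 * paramT ε β := by gcongr

/-! ### The complexity -/

/-- Uniformly in β, K ≤ 15/ε and B ≥ (9/225) ε², so K/B ≤ 375 ε⁻³ ≤ ε⁻⁶, because 375 ≤ 16³. -/
theorem log_paramK_div_paramB_le {ε β : ℝ} (hε : 0 < ε) (hε1 : ε ≤ 1 / 16) (hβ : 0 ≤ β)
    (hβ1 : β ≤ 1) : Real.log (paramK ε β / paramB ε β) ≤ 6 * Real.log ε⁻¹ := by
  have hε1' : ε ≤ 1 := by linarith
  have hB := paramB_pos (β := β) hε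
  have hK := four_le_paramK (β := β) hε hε1' hβ1
  have hx : (16 : ℝ) ≤ ε⁻¹ := by
    rw [le_inv_comm₀ (by norm_num) hε]
    linarith
  have hKle : paramK ε β ≤ 15 * ε⁻¹ := by
    rw [paramK, ← Real.rpow_neg_one]
    gcongr 15 * ?_
    exact Real.rpow_le_rpow_of_exponent_ge hε hε1' (by linarith)
  have hBge : 9 / 225 * ε ^ 2 ≤ paramB ε β := by
    refine le_min ?_ ?_
    · gcongr 9 / 225 * ?_
      rw [← Real.rpow_natCast ε 2]
      exact Real.rpow_le_rpow_of_exponent_ge hε hε1' (by push_cast; linarith)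
    · nlinarith
  rw [show (6 : ℝ) = ((6 : ℕ) : ℝ) by norm_num, ← Real.log_pow]
  refine Real.log_le_log (by positivity) ?_
  calc paramK ε β / paramB ε β ≤ (15 * ε⁻¹) / (9 / 225 * ε ^ 2) := by gcongr
    _ = 375 * ε⁻¹ ^ 3 := by field_simp; norm_num
    _ ≤ ε⁻¹ ^ 3 * ε⁻¹ ^ 3 := by
        gcongr
        calc (375 : ℝ) ≤ 16 ^ 3 := by norm_num
          _ ≤ _ := by gcongr
    _ = ε⁻¹ ^ 6 := by ring

/-- From 15 ≤ ε⁻¹ follows K ≤ ε⁻², and from log ε⁻¹ ≥ 2 follows log K ≤ 2 log ε⁻¹ ≤ (log ε⁻¹)². -/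
theorem log_log_paramK_le {ε β : ℝ} (hε : 0 < ε) (hε1 : ε ≤ 1 / 16) (hβ : 0 ≤ β)
    (hβ1 : β ≤ 1) : Real.log (Real.log (paramK ε β)) ≤ 2 * Real.log (Real.log ε⁻¹) := by
  have hε1' : ε ≤ 1 := by linarith
  have hK := four_le_paramK (β := β) hε hε1' hβ1
  have hx : (16 : ℝ) ≤ ε⁻¹ := by
    rw [le_inv_comm₀ (by norm_num) hε]
    linarith
  have hlog : 2 ≤ Real.log ε⁻¹ := by
    have h := Real.log_le_log (by norm_num) hx
    rw [show (16 : ℝ) = 2 ^ 4 by norm_num, Real.log_pow] at h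
    have := Real.log_two_gt_d9
    push_cast at h
    linarith
  have hKle : paramK ε β ≤ ε⁻¹ ^ 2 := by
    calc paramK ε β ≤ 15 * ε⁻¹ := by
          rw [paramK, ← Real.rpow_neg_one]
          gcongr 15 * ?_
          exact Real.rpow_le_rpow_of_exponent_ge hε hε1' (by linarith)
      _ ≤ ε⁻¹ * ε⁻¹ := by gcongr; linarith
      _ = _ := by ring
  have hlogK : 0 < Real.log (paramK ε β) := Real.log_pos (by linarith)
  rw [show 2 * Real.log (Real.log ε⁻¹) = Real.log (Real.log ε⁻¹ ^ 2) by rw [Real.log_pow]; norm_num]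
  refine Real.log_le_log hlogK ?_
  calc Real.log (paramK ε β) ≤ Real.log (ε⁻¹ ^ 2) := Real.log_le_log (by linarith) hKle
    _ = 2 * Real.log ε⁻¹ := by rw [Real.log_pow]; norm_num
    _ ≤ Real.log ε⁻¹ * Real.log ε⁻¹ := by gcongr
    _ = _ := by ring

theorem IsUnbiasedAE.exists_complexity_bound {F : AlgFamily} (hF : IsUnbiasedAE F) :
    ∃ C : ℝ, ∀ (ε β : ℝ), 0 < ε → ε ≤ 1 / 16 → 0 ≤ β → β ≤ 1 → ∀ (n : ℕ) [NeZero n],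
      (parallelDepth (lowDepthRuns F n ε β) : ℝ) ≤
          C * (ε ^ (-1 + β) * Real.log (Real.log ε⁻¹) * Real.log ε⁻¹) ∧
      (parallelQueries (lowDepthRuns F n ε β) : ℝ) ≤
          C * (ε ^ (-1 - β) * Real.log (Real.log ε⁻¹) * Real.log ε⁻¹) := by
  obtain ⟨C, hC⟩ := hF.queries
  -- One run costs at most 15 · 2 · 6 = 180 times |C|: 15 from K, 2 from log log K, 6 from log(K/B).
  -- The rounding in T costs another factor 2. The absolute value is needed because C is not assumed
  -- nonnegative.
  refine ⟨360 * |C|, fun ε β hε hε1 hβ hβ1 n _ => ?_⟩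
  have hε1' : ε ≤ 1 := by linarith
  have hK := four_le_paramK (β := β) hε hε1' hβ1
  have hB := paramB_pos (β := β) hε
  have hlK := log_paramK_div_paramB_le hε hε1 hβ hβ1
  have hllK := log_log_paramK_le hε hε1 hβ hβ1
  obtain ⟨hl1, hl2, -⟩ := log_log_nonneg_and_log_pos hK
  have hKB : 0 ≤ Real.log (paramK ε β / paramB ε β) := by
    refine Real.log_nonneg ((one_le_div hB).2 ?_)
    linarith [paramB_lt_one (ε := ε) (β := β) hε1']
  have hq : ((F n (paramK ε β) (paramB ε β)).queries : ℝ) ≤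
      180 * |C| * (ε ^ (-1 + β) * Real.log (Real.log ε⁻¹) * Real.log ε⁻¹) := by
    calc ((F n (paramK ε β) (paramB ε β)).queries : ℝ)
        ≤ C * (paramK ε β * Real.log (Real.log (paramK ε β)) *
            Real.log (paramK ε β / paramB ε β)) :=
          hC n _ _ hK hB (paramB_lt_one hε1')
      _ ≤ |C| * (paramK ε β * Real.log (Real.log (paramK ε β)) *
            Real.log (paramK ε β / paramB ε β)) := by
          gcongr
          · exact mul_nonneg (mul_nonneg (by linarith) (by linarith)) hKB
          · exact le_abs_self C
      _ ≤ |C| * (paramK ε β * (2 * Real.log (Real.log ε⁻¹)) * (6 * Real.log ε⁻¹)) := by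
          have : 0 ≤ 2 * Real.log (Real.log ε⁻¹) := by linarith
          gcongr
      _ = _ := by rw [paramK]; ring
  have hpos : 0 ≤ ε ^ (-1 + β) * Real.log (Real.log ε⁻¹) * Real.log ε⁻¹ := by
    refine mul_nonneg (mul_nonneg (by positivity) ?_) ?_ <;> linarith
  constructor
  · have : parallelDepth (lowDepthRuns F n ε β) ≤ (F n (paramK ε β) (paramB ε β)).queries :=
      Finset.sup_le fun i _ => le_rfl
    calc (parallelDepth (lowDepthRuns F n ε β) : ℝ)
        ≤ (F n (paramK ε β) (paramB ε β)).queries := by exact_mod_cast this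
      _ ≤ _ := hq
      _ ≤ _ := by gcongr; norm_num
  · have hT : (paramT ε β : ℝ) ≤ 2 * ε ^ (-2 * β) := by
      have h1 : 1 ≤ ε ^ (-2 * β) :=
        Real.one_le_rpow_of_pos_of_le_one_of_nonpos hε hε1' (by linarith)
      have := Nat.ceil_lt_add_one (zero_le_one.trans h1)
      unfold paramT
      linarith
    have hmul : ε ^ (-2 * β) * ε ^ (-1 + β) = ε ^ (-1 - β) := by
      rw [← Real.rpow_add hε]
      congr 1
      ring
    calc (parallelQueries (lowDepthRuns F n ε β) : ℝ)
        = paramT ε β * (F n (paramK ε β) (paramB ε β)).queries := by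
          simp [parallelQueries, lowDepthRuns]
      _ ≤ (2 * ε ^ (-2 * β)) *
          (180 * |C| * (ε ^ (-1 + β) * Real.log (Real.log ε⁻¹) * Real.log ε⁻¹)) := by gcongr
      _ = _ := by rw [← hmul]; ring

end LowDepthQAE

theorem mainTheorem4 :
    (∃ F : LowDepthQAE.AlgFamily, LowDepthQAE.IsUnbiasedAE F) ∧
    ∀ F : LowDepthQAE.AlgFamily, LowDepthQAE.IsUnbiasedAE F →
      (∀ (ε β : ℝ), 0 < ε → ε < 1 → 0 ≤ β → β ≤ 1 →
        ∀ (n : ℕ) [NeZero n] (I : LowDepthQAE.Instance n),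
          1 / 2 < (LowDepthQAE.parallelLaw (LowDepthQAE.lowDepthRuns F n ε β) I).real
            {y | |LowDepthQAE.sampleMean y - I.amplitude| ≤ ε}) ∧
      ∃ C : ℝ, ∀ (ε β : ℝ), 0 < ε → ε ≤ 1 / 16 → 0 ≤ β → β ≤ 1 → ∀ (n : ℕ) [NeZero n],
        (LowDepthQAE.parallelDepth (LowDepthQAE.lowDepthRuns F n ε β) : ℝ) ≤
            C * (ε ^ (-1 + β) * Real.log (Real.log ε⁻¹) * Real.log ε⁻¹) ∧
        (LowDepthQAE.parallelQueries (LowDepthQAE.lowDepthRuns F n ε β) : ℝ) ≤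
            C * (ε ^ (-1 - β) * Real.log (Real.log ε⁻¹) * Real.log ε⁻¹) := by
  exact ⟨⟨_, LowDepthQAE.isUnbiasedAE_walkFamily⟩, fun F hF =>
    ⟨fun _ _ hε hε1 _ hβ1 _ _ I => hF.half_lt_parallelLaw hε hε1 hβ1 I,
      hF.exists_complexity_bound⟩⟩
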